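/- Let $\Sigma$ be a finite alphabet. $\mathbf{FO}_2[<]$ denotes the class of first-order sentences, interpreted over the positions of finite words $w\in\Sigma^*$ (including the empty word), built with at most two distinct variables (which may be requantified) from the label predicates $Q_a x$ ("position $x$ holds the letter $a$", $a\in\Sigma$), the order $x<y$ and equality of positions, the Boolean constants and connectives, and the quantifiers $\exists,\forall$. $\mathbf{DA}$ denotes the class of finite monoids $M$ satisfying $$(xy)^\omega\, y\,(xy)^\omega=(xy)^\omega\qquad\text{for all }x,y\in M,$$ where $\omega\ge 1$ is an integer such that $z^\omega$ is idempotent for every $z\in M$. A monoid $M$ recognizes $L\subseteq\Sigma^*$ if $L=\rho^{-1}(F)$ for some homomorphism $\rho:\Sigma^*\to M$ and some $F\subseteq M$; the syntactic monoid of $L$ is the quotient of $\Sigma^*$ by the congruence $x\equiv_L y\iff(\forall u,v\in\Sigma^*:\ uxv\in L\Leftrightarrow uyv\in L)$. **Theorem (Thérien–Wilke).** $\mathrm{L}(\mathbf{FO}_2[<])=\mathrm{L}(\mathbf{DA})$. That is, for every language $L\subseteq\Sigma^*$: $L$ is definable by an $\mathbf{FO}_2[<]$ sentence if and only if $L$ is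 recognized by some monoid in $\mathbf{DA}$; equivalently, $L$ is definable by an $\mathbf{FO}_2[<]$ sentence if and only if the syntactic monoid of $L$ lies in $\mathbf{DA}$. -/

import Mathlib

/-- First-order formulas over words on the alphabet `A`, with variables `x_0, …, x_{k-1}` only
(a variable may be quantified again inside the scope of a quantifier over it), the label
predicates `Q_a x`, and the numerical predicate `<` (and equality of positions). -/
inductive FOFormula (A : Type*) (k : ℕ) : Type _
  | tru : FOFormula A k
  | fls : FOFormula A k
  | label (a : A) (i : Fin k) : FOFormula A k
  | lt (i j : Fin k) : FOFormula A k
  | eq (i j : Fin k) : FOFormula A k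
  | neg (φ : FOFormula A k) : FOFormula A k
  | conj (φ ψ : FOFormula A k) : FOFormula A k
  | disj (φ ψ : FOFormula A k) : FOFormula A k
  | ex (i : Fin k) (φ : FOFormula A k) : FOFormula A k
  | all (i : Fin k) (φ : FOFormula A k) : FOFormula A k

namespace FOFormula

/-- The variables that occur free in a formula. -/
def freeVars {A : Type*} {k : ℕ} : FOFormula A k → Set (Fin k)
  | tru => ∅
  | fls => ∅
  | label _ i => {i}
  | lt i j => {i, j}
  | eq i j => {i, j}
  | neg φ => φ.freeVars
  | conj φ ψ => φ.freeVars ∪ ψ.freeVars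
  | disj φ ψ => φ.freeVars ∪ ψ.freeVars
  | ex i φ => φ.freeVars \ {i}
  | all i φ => φ.freeVars \ {i}

/-- A sentence is a formula without free variables. -/
def IsSentence {A : Type*} {k : ℕ} (φ : FOFormula A k) : Prop :=
  φ.freeVars = ∅

/-- `φ.Sat w p` means `(w, p) ⊨ φ`. The positions of `w` are `0, …, |w| - 1`, the variable `x_i`
points to `p i`, and quantifiers range over the positions of `w`. -/
def Sat {A : Type*} {k : ℕ} (w : List A) : FOFormula A k → (Fin k → ℕ) → Prop
  | tru, _ => True
  | fls, _ => False
  | label a i, p => w[p i]? = some a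
  | lt i j, p => p i < p j
  | eq i j, p => p i = p j
  | neg φ, p => ¬ φ.Sat w p
  | conj φ ψ, p => φ.Sat w p ∧ ψ.Sat w p
  | disj φ ψ, p => φ.Sat w p ∨ ψ.Sat w p
  | ex i φ, p => ∃ q, q < w.length ∧ φ.Sat w (Function.update p i q)
  | all i φ, p => ∀ q, q < w.length → φ.Sat w (Function.update p i q)

/-- The language `L_φ` defined by a sentence `φ`; the initial pointers are irrelevant, as `φ` has
no free variables. -/
def language {A : Type*} {k : ℕ} (φ : FOFormula A k) : Language A :=
  {w : List A | φ.Sat w (fun _ => 0)}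

end FOFormula

/-- `L` is definable in `FO_k[<]`: by a first-order sentence over `<` with at most `k` distinct
variables. -/
def Language.IsFODefinable {A : Type*} (k : ℕ) (L : Language A) : Prop :=
  ∃ φ : FOFormula A k, φ.IsSentence ∧ φ.language = L

/-- `n` is an exponent (an `ω`) of `M`: `n ≥ 1` and `x ^ n` is idempotent for every `x`. -/
def IsOmega (M : Type*) [Monoid M] (n : ℕ) : Prop :=
  0 < n ∧ ∀ x : M, IsIdempotentElem (x ^ n)

/-- The pseudovariety `DA`: finite monoids satisfying `(xy)^ω y (xy)^ω = (xy)^ω`. -/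
def InDA (M : Type*) [Monoid M] : Prop :=
  Finite M ∧ ∃ n : ℕ, IsOmega M n ∧
    ∀ x y : M, (x * y) ^ n * y * (x * y) ^ n = (x * y) ^ n

/-- The monoid `M` recognizes `L`: `L = ρ⁻¹(F)` for a homomorphism `ρ : A^* → M` and `F ⊆ M`. -/
def Language.IsRecognizedBy {A : Type*} (L : Language A) (M : Type*) [Monoid M] : Prop :=
  ∃ (ρ : FreeMonoid A →* M) (F : Set M),
    ∀ w : List A, w ∈ L ↔ ρ (FreeMonoid.ofList w) ∈ F

/-- The syntactic congruence of `L`: `x ≡ y` iff `uxv ∈ L ↔ uyv ∈ L` for all words `u`, `v`. -/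
def Language.syntacticCon {A : Type*} (L : Language A) : Con (FreeMonoid A) where
  r x y := ∀ u v : FreeMonoid A,
    FreeMonoid.toList (u * x * v) ∈ L ↔ FreeMonoid.toList (u * y * v) ∈ L
  iseqv := ⟨fun _ _ _ => Iff.rfl, fun h u v => (h u v).symm,
    fun h h' u v => (h u v).trans (h' u v)⟩
  mul' := by
    intro x x' y y' h h' u v
    have h1 := h u (y * v)
    have h2 := h' (u * x') v
    simp only [mul_assoc] at h1 h2 ⊢
    exact h1.trans h2

/-- The syntactic monoid `A^* / ≡_L`. -/
abbrev Language.SyntacticMonoid {A : Type*} (L : Language A) : Type _ :=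
  L.syntacticCon.Quotient

-- The link between logic and algebra is the Ehrenfeucht–Fraïssé game with two pebbles. A move keeps
-- only one old pebble, so the depth-`k + 1` type of a position consists of its letter and the
-- depth-`k` types found to its left and to its right. There are finitely many types, each is
-- definable, and a sentence depends only on types up to some depth. Hence the definable languages
-- are the unions of classes of `wordType k` for some `k`.
--
-- Logic to algebra: `wordType k` is a congruence of finite index (`wordType_append`). Between two
-- copies of `x ^ (k + 1)`, a factor using only letters of `x` cannot be detected
-- (`wordType_eq_of_isPumped`), which yields the identity of DA in the quotient. The syntactic
-- monoid inherits it.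
--
-- Algebra to logic: let `ρ` map words to a monoid in DA. By induction on the number of letters in
-- `u`, deep enough types determine `ρ u`. In DA, `t * c = t` implies that `t * b` generates the
-- same right ideal as `t` for every factor `b` of `c`. So when `u` is read from the left, a letter
-- that makes this ideal shrink has not occurred since the previous drop: it is a first occurrence,
-- which types can locate (`exists_first_factorization`). The part before it has fewer letters, and
-- the number of drops is bounded. This gives `ρ u ∣ ρ v` for words of equal type; the mirror image
-- gives left divisibility, and the two together force equality (`InDA.eq_of_dvd`).

universe u

/-! ### Two-variable types and the game that compares them -/

/-- The finite set of possible values of `positionType k`. -/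
def RankType (A : Type u) : ℕ → Type u
  | 0 => Option A
  | k + 1 => Option A × Set (RankType A k) × Set (RankType A k)

instance RankType.finite (A : Type u) [Finite A] : ∀ k, Finite (RankType A k)
  | 0 => inferInstanceAs (Finite (Option A))
  | k + 1 => by
    have := RankType.finite A k
    exact inferInstanceAs (Finite (Option A × Set (RankType A k) × Set (RankType A k)))

/-- The two-variable type of quantifier depth `k` of the position `i` in the word `w`. -/
def positionType {A : Type u} : (k : ℕ) → List A → ℕ → RankType A k
  | 0, w, i => w[i]?
  | k + 1, w, i => (w[i]?, {t | ∃ j < i, j < w.length ∧ positionType k w j = t},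
      {t | ∃ j > i, j < w.length ∧ positionType k w j = t})

/-- The set of types of quantifier depth `k` that are realized in the word `w`. -/
def wordType {A : Type u} (k : ℕ) (w : List A) : Set (RankType A k) :=
  {t | ∃ j < w.length, positionType k w j = t}

section Types

variable {A : Type u} {k : ℕ} {w w' : List A} {i i' : ℕ}

theorem setOf_eq_iff_forth {α : Type*} {p p' : ℕ → Prop} {f f' : ℕ → α} :
    {t | ∃ j, p j ∧ f j = t} = {t | ∃ j, p' j ∧ f' j = t} ↔
      (∀ j, p j → ∃ j', p' j' ∧ f j = f' j') ∧ (∀ j, p' j → ∃ j', p j' ∧ f' j = f j') := by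
  constructor
  · intro h
    constructor
    · intro j hj
      obtain ⟨j', h1, h2⟩ := h.subset ⟨j, hj, rfl⟩
      exact ⟨j', h1, h2.symm⟩
    · intro j hj
      obtain ⟨j', h1, h2⟩ := h.superset ⟨j, hj, rfl⟩
      exact ⟨j', h1, h2.symm⟩
  · rintro ⟨h, h'⟩
    ext t
    constructor
    · rintro ⟨j, hj, rfl⟩
      obtain ⟨j', h1, h2⟩ := h j hj
      exact ⟨j', h1, h2.symm⟩
    · rintro ⟨j, hj, rfl⟩
      obtain ⟨j', h1, h2⟩ := h' j hj
      exact ⟨j', h1, h2.symm⟩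

/-- Every move of the first player from `i` in `w` can be answered from `i'` in `w'`. -/
def Forth (k : ℕ) (w : List A) (i : ℕ) (w' : List A) (i' : ℕ) : Prop :=
  (∀ j < i, j < w.length → ∃ j' < i', j' < w'.length ∧ positionType k w j = positionType k w' j') ∧
  (∀ j > i, j < w.length → ∃ j' > i', j' < w'.length ∧ positionType k w j = positionType k w' j')

theorem positionType_succ_eq_iff :
    positionType (k + 1) w i = positionType (k + 1) w' i' ↔
      w[i]? = w'[i']? ∧ Forth k w i w' i' ∧ Forth k w' i' w i := by
  have h1 := setOf_eq_iff_forth (p := fun j => j < i ∧ j < w.length)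
    (p' := fun j => j < i' ∧ j < w'.length) (f := positionType k w) (f' := positionType k w')
  have h2 := setOf_eq_iff_forth (p := fun j => j > i ∧ j < w.length)
    (p' := fun j => j > i' ∧ j < w'.length) (f := positionType k w) (f' := positionType k w')
  simp only [and_assoc, and_imp] at h1 h2
  simp only [positionType]
  refine Prod.mk_inj.trans (and_congr_right fun _ => Prod.mk_inj.trans ?_)
  rw [h1, h2]
  simp only [Forth]
  tauto

theorem wordType_eq_iff :
    wordType k w = wordType k w' ↔
      (∀ j < w.length, ∃ j' < w'.length, positionType k w j = positionType k w' j') ∧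
      (∀ j < w'.length, ∃ j' < w.length, positionType k w' j = positionType k w j') :=
  setOf_eq_iff_forth

theorem getElem?_eq_of_positionType_eq (h : positionType k w i = positionType k w' i') :
    w[i]? = w'[i']? := by
  cases k with
  | zero => exact h
  | succ k => exact (positionType_succ_eq_iff.1 h).1

theorem lt_length_iff_of_positionType_eq (h : positionType k w i = positionType k w' i') :
    i < w.length ↔ i' < w'.length := by
  have := getElem?_eq_of_positionType_eq h
  have h1 := List.getElem?_eq_none_iff (l := w) (i := i)
  have h2 := List.getElem?_eq_none_iff (l := w') (i := i')
  rw [this, h2] at h1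
  omega

theorem Forth.imp {m : ℕ} (hm : ∀ j j', positionType k w j = positionType k w' j' →
    positionType m w j = positionType m w' j') (h : Forth k w i w' i') : Forth m w i w' i' := by
  constructor
  · intro j hj hl
    obtain ⟨j', h1, h2, h3⟩ := h.1 j hj hl
    exact ⟨j', h1, h2, hm _ _ h3⟩
  · intro j hj hl
    obtain ⟨j', h1, h2, h3⟩ := h.2 j hj hl
    exact ⟨j', h1, h2, hm _ _ h3⟩

theorem positionType_eq_of_succ :
    ∀ {k : ℕ} {w w' : List A} {i i' : ℕ}, positionType (k + 1) w i = positionType (k + 1) w' i' →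
      positionType k w i = positionType k w' i'
  | 0, _, _, _, _, h => (positionType_succ_eq_iff.1 h).1
  | _ + 1, _, _, _, _, h => by
    obtain ⟨h1, h2, h3⟩ := positionType_succ_eq_iff.1 h
    exact positionType_succ_eq_iff.2 ⟨h1, h2.imp fun _ _ => positionType_eq_of_succ,
      h3.imp fun _ _ => positionType_eq_of_succ⟩

theorem positionType_eq_of_le {m : ℕ} (hm : m ≤ k)
    (h : positionType k w i = positionType k w' i') :
    positionType m w i = positionType m w' i' := by
  induction k, hm using Nat.le_induction with
  | base => exact h
  | succ k _ ih => exact ih (positionType_eq_of_succ h)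

theorem wordType_eq_of_le {m : ℕ} (hm : m ≤ k) (h : wordType k w = wordType k w') :
    wordType m w = wordType m w' := by
  rw [wordType_eq_iff] at h ⊢
  constructor
  · intro j hj
    obtain ⟨j', h1, h2⟩ := h.1 j hj
    exact ⟨j', h1, positionType_eq_of_le hm h2⟩
  · intro j hj
    obtain ⟨j', h1, h2⟩ := h.2 j hj
    exact ⟨j', h1, positionType_eq_of_le hm h2⟩

/-- Positions related by a winning strategy of the second player have the same type. -/
theorem positionType_eq_of_game (G : ℕ → List A → ℕ → List A → ℕ → Prop)
    (symm : ∀ {k w i w' i'}, G k w i w' i' → G k w' i' w i)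
    (label : ∀ {k w i w' i'}, G k w i w' i' → w[i]? = w'[i']?)
    (left : ∀ {k w i w' i'}, G (k + 1) w i w' i' → ∀ j < i, j < w.length →
      ∃ j' < i', j' < w'.length ∧ G k w j w' j')
    (right : ∀ {k w i w' i'}, G (k + 1) w i w' i' → ∀ j > i, j < w.length →
      ∃ j' > i', j' < w'.length ∧ G k w j w' j') :
    ∀ {k w i w' i'}, G k w i w' i' → positionType k w i = positionType k w' i' := by
  intro k
  induction k with
  | zero =>
    intro w i w' i' h
    exact label h
  | succ k ih =>
    have forth : ∀ {w i w' i'}, G (k + 1) w i w' i' → Forth k w i w' i' := by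
      intro w i w' i' h
      constructor
      · intro j hj hl
        obtain ⟨j', h1, h2, h3⟩ := left h j hj hl
        exact ⟨j', h1, h2, ih h3⟩
      · intro j hj hl
        obtain ⟨j', h1, h2, h3⟩ := right h j hj hl
        exact ⟨j', h1, h2, ih h3⟩
    intro w i w' i' h
    exact positionType_succ_eq_iff.2 ⟨label h, forth h, forth (symm h)⟩

theorem mem_iff_of_wordType_eq (h : wordType k w = wordType k w') (a : A) : a ∈ w ↔ a ∈ w' := by
  have key : ∀ {w w' : List A},
      (∀ j < w.length, ∃ j' < w'.length, positionType k w j = positionType k w' j') →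
      a ∈ w → a ∈ w' := by
    intro w w' h ha
    obtain ⟨j, hj⟩ := List.mem_iff_getElem?.1 ha
    obtain ⟨j', -, h2⟩ := h j (List.getElem?_eq_some_iff.1 hj).1
    exact List.mem_iff_getElem?.2 ⟨j', (getElem?_eq_of_positionType_eq h2).symm.trans hj⟩
  rw [wordType_eq_iff] at h
  exact ⟨key h.1, key h.2⟩

end Types

/-! ### Word types form a congruence of finite index -/

section Append

variable {A : Type u} {k : ℕ}

/-- The second player plays on the two factors separately. -/
def AppendGame (k : ℕ) (w : List A) (i : ℕ) (w' : List A) (i' : ℕ) : Prop :=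
  ∃ x y x' y', w = x ++ y ∧ w' = x' ++ y' ∧ wordType k x = wordType k x' ∧
    wordType k y = wordType k y' ∧
    ((i < x.length ∧ i' < x'.length ∧ positionType k x i = positionType k x' i') ∨
      ∃ m m', i = x.length + m ∧ i' = x'.length + m' ∧ m < y.length ∧ m' < y'.length ∧
        positionType k y m = positionType k y' m')

/-- A move within the current factor is answered by the type of the current position, a move into
the other factor by the equality of word types there. -/
theorem AppendGame.positionType_eq {w w' : List A} {i i' : ℕ} (h : AppendGame k w i w' i') :
    positionType k w i = positionType k w' i' := by
  refine positionType_eq_of_game AppendGame ?_ ?_ ?_ ?_ h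
  · rintro k w i w' i' ⟨x, y, x', y', h1, h2, h3, h4, h⟩
    refine ⟨x', y', x, y, h2, h1, h3.symm, h4.symm, ?_⟩
    rcases h with ⟨h, h', h5⟩ | ⟨m, m', h5, h6, h7, h8, h9⟩
    · exact Or.inl ⟨h', h, h5.symm⟩
    · exact Or.inr ⟨m', m, h6, h5, h8, h7, h9.symm⟩
  · rintro k w i w' i' ⟨x, y, x', y', rfl, rfl, h3, h4, h⟩
    rcases h with ⟨h, h', h5⟩ | ⟨m, m', rfl, rfl, h7, h8, h9⟩
    · rw [List.getElem?_append_left h, List.getElem?_append_left h']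
      exact getElem?_eq_of_positionType_eq h5
    · rw [List.getElem?_append_right (by omega), List.getElem?_append_right (by omega)]
      simpa using getElem?_eq_of_positionType_eq h9
  · rintro k w i w' i' ⟨x, y, x', y', rfl, rfl, h3, h4, h⟩ j hj hl
    have h3' := wordType_eq_of_le k.le_succ h3
    have h4' := wordType_eq_of_le k.le_succ h4
    rcases h with ⟨h, h', h5⟩ | ⟨m, m', rfl, rfl, h7, h8, h9⟩
    · obtain ⟨j', h6, h7, h8⟩ := (positionType_succ_eq_iff.1 h5).2.1.1 j hj (by omega)
      exact ⟨j', h6, by simp; omega, x, y, x', y', rfl, rfl, h3', h4',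
        Or.inl ⟨by omega, h7, h8⟩⟩
    · rcases lt_or_ge j x.length with hjx | hjx
      · obtain ⟨j', h6, h7⟩ := (wordType_eq_iff.1 h3').1 j hjx
        exact ⟨j', by omega, by simp; omega, x, y, x', y', rfl, rfl, h3', h4',
          Or.inl ⟨hjx, h6, h7⟩⟩
      · obtain ⟨j, rfl⟩ := Nat.exists_eq_add_of_le hjx
        obtain ⟨j', h6, h7, h8⟩ := (positionType_succ_eq_iff.1 h9).2.1.1 j (by omega) (by omega)
        exact ⟨x'.length + j', by omega, by simp; omega, x, y, x', y', rfl, rfl, h3', h4',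
          Or.inr ⟨j, j', rfl, rfl, by omega, h7, h8⟩⟩
  · rintro k w i w' i' ⟨x, y, x', y', rfl, rfl, h3, h4, h⟩ j hj hl
    have h3' := wordType_eq_of_le k.le_succ h3
    have h4' := wordType_eq_of_le k.le_succ h4
    rw [List.length_append] at hl
    rcases lt_or_ge j x.length with hjx | hjx
    · rcases h with ⟨h, h', h5⟩ | ⟨m, m', rfl, rfl, h7, h8, h9⟩
      · obtain ⟨j', h6, h7, h8⟩ := (positionType_succ_eq_iff.1 h5).2.1.2 j hj hjx
        exact ⟨j', h6, by simp; omega, x, y, x', y', rfl, rfl, h3', h4', Or.inl ⟨hjx, h7, h8⟩⟩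
      · omega
    · obtain ⟨j, rfl⟩ := Nat.exists_eq_add_of_le hjx
      rcases h with ⟨h, h', h5⟩ | ⟨m, m', rfl, rfl, h7, h8, h9⟩
      · obtain ⟨j', h6, h7⟩ := (wordType_eq_iff.1 h4').1 j (by omega)
        exact ⟨x'.length + j', by omega, by simp; omega, x, y, x', y', rfl, rfl, h3', h4',
          Or.inr ⟨j, j', rfl, rfl, by omega, h6, h7⟩⟩
      · obtain ⟨j', h6, h7, h8⟩ := (positionType_succ_eq_iff.1 h9).2.1.2 j (by omega) (by omega)
        exact ⟨x'.length + j', by omega, by simp; omega, x, y, x', y', rfl, rfl, h3', h4',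
          Or.inr ⟨j, j', rfl, rfl, by omega, h7, h8⟩⟩

theorem wordType_append {x x' y y' : List A} (hx : wordType k x = wordType k x')
    (hy : wordType k y = wordType k y') : wordType k (x ++ y) = wordType k (x' ++ y') := by
  have key : ∀ {x x' y y' : List A}, wordType k x = wordType k x' → wordType k y = wordType k y' →
      ∀ j < (x ++ y).length, ∃ j' < (x' ++ y').length,
        positionType k (x ++ y) j = positionType k (x' ++ y') j' := by
    intro x x' y y' hx hy j hj
    rw [List.length_append] at hj
    rcases lt_or_ge j x.length with hjx | hjx
    · obtain ⟨j', h1, h2⟩ := (wordType_eq_iff.1 hx).1 j hjx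
      exact ⟨j', by simp; omega, AppendGame.positionType_eq
        ⟨x, y, x', y', rfl, rfl, hx, hy, Or.inl ⟨hjx, h1, h2⟩⟩⟩
    · obtain ⟨j, rfl⟩ := Nat.exists_eq_add_of_le hjx
      obtain ⟨j', h1, h2⟩ := (wordType_eq_iff.1 hy).1 j (by omega)
      exact ⟨x'.length + j', by simp; omega, AppendGame.positionType_eq
        ⟨x, y, x', y', rfl, rfl, hx, hy, Or.inr ⟨j, j', rfl, rfl, by omega, h1, h2⟩⟩⟩
  exact wordType_eq_iff.2 ⟨key hx hy, key hx.symm hy.symm⟩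

/-- Equality of word types as a congruence on the free monoid. -/
def wordTypeCon (A : Type u) (k : ℕ) : Con (FreeMonoid A) where
  r x y := wordType k (FreeMonoid.toList x) = wordType k (FreeMonoid.toList y)
  iseqv := ⟨fun _ => rfl, Eq.symm, Eq.trans⟩
  mul' h h' := wordType_append h h'

theorem finite_wordTypeCon_quotient (A : Type u) [Finite A] (k : ℕ) :
    Finite (wordTypeCon A k).Quotient :=
  Finite.of_injective
    (Quotient.lift (fun x : FreeMonoid A => wordType k (FreeMonoid.toList x)) fun _ _ h => h)
    (by
      rintro ⟨x⟩ ⟨y⟩ h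
      exact Quotient.sound h)

end Append

/-! ### Two-variable sentences depend only on word types -/

section Formulas

variable {A : Type u}

theorem exists_reply {k : ℕ} {w w' : List A} {a a' q : ℕ}
    (h : positionType (k + 1) w a = positionType (k + 1) w' a') (hq : q < w.length) :
    ∃ q' < w'.length, positionType k w q = positionType k w' q' ∧ (q < a ↔ q' < a') ∧
      (a < q ↔ a' < q') := by
  obtain ⟨-, h1, -⟩ := positionType_succ_eq_iff.1 h
  rcases lt_trichotomy q a with hl | rfl | hl
  · obtain ⟨q', h2, h3, h4⟩ := h1.1 q hl hq
    exact ⟨q', h3, h4, by omega, by omega⟩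
  · exact ⟨a', (lt_length_iff_of_positionType_eq h).1 hq, positionType_eq_of_succ h, by simp,
      by simp⟩
  · obtain ⟨q', h2, h3, h4⟩ := h1.2 q hl hq
    exact ⟨q', h3, h4, by omega, by omega⟩

/-- The pointers `p` into `w` and `p'` into `w'` have the same depth-`k` types and order type. -/
def SameType (k : ℕ) (w w' : List A) (p p' : Fin 2 → ℕ) : Prop :=
  (∀ i, positionType k w (p i) = positionType k w' (p' i)) ∧ ∀ i j, p i < p j ↔ p' i < p' j

theorem SameType.symm {k : ℕ} {w w' : List A} {p p' : Fin 2 → ℕ} (h : SameType k w w' p p') :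
    SameType k w' w p' p :=
  ⟨fun i => (h.1 i).symm, fun i j => (h.2 i j).symm⟩

theorem SameType.of_le {k m : ℕ} (hm : m ≤ k) {w w' : List A} {p p' : Fin 2 → ℕ}
    (h : SameType k w w' p p') : SameType m w w' p p' :=
  ⟨fun i => positionType_eq_of_le hm (h.1 i), h.2⟩

/-- This is where two variables matter: moving one pointer leaves a single other one, so a reply
chosen from that pointer's type alone restores the whole invariant. -/
theorem SameType.exists_update {k : ℕ} {w w' : List A} {p p' : Fin 2 → ℕ}
    (h : SameType (k + 1) w w' p p') (i : Fin 2) {q : ℕ} (hq : q < w.length) :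
    ∃ q' < w'.length, SameType k w w' (Function.update p i q) (Function.update p' i q') := by
  obtain ⟨j, hj⟩ : ∃ j : Fin 2, j ≠ i := exists_ne i
  have hij : ∀ l, l = i ∨ l = j := by omega
  obtain ⟨q', h1, h2, h3, h4⟩ := exists_reply (h.1 j) hq
  refine ⟨q', h1, ?_, ?_⟩
  · intro l
    rcases hij l with rfl | rfl
    · simpa using h2
    · simpa [hj] using positionType_eq_of_succ (h.1 l)
  · intro l l'
    rcases hij l with rfl | rfl <;> rcases hij l' with rfl | rfl <;> simp [hj, h3, h4]

theorem FOFormula.exists_sat_iff_of_sameType (φ : FOFormula A 2) :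
    ∃ k, ∀ w w' p p', SameType k w w' p p' → (φ.Sat w p ↔ φ.Sat w' p') := by
  induction φ with
  | tru => exact ⟨0, fun _ _ _ _ _ => Iff.rfl⟩
  | fls => exact ⟨0, fun _ _ _ _ _ => Iff.rfl⟩
  | label a i =>
    refine ⟨0, fun w w' p p' h => ?_⟩
    simp only [Sat]
    rw [getElem?_eq_of_positionType_eq (h.1 i)]
  | lt i j => exact ⟨0, fun w w' p p' h => h.2 i j⟩
  | eq i j =>
    refine ⟨0, fun w w' p p' h => ?_⟩
    simp only [Sat]
    have h1 := h.2 i j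
    have h2 := h.2 j i
    omega
  | neg φ ih =>
    obtain ⟨k, hk⟩ := ih
    exact ⟨k, fun w w' p p' h => not_congr (hk w w' p p' h)⟩
  | conj φ ψ ih ih' =>
    obtain ⟨k, hk⟩ := ih
    obtain ⟨k', hk'⟩ := ih'
    exact ⟨max k k', fun w w' p p' h => and_congr (hk w w' p p' (h.of_le (le_max_left _ _)))
      (hk' w w' p p' (h.of_le (le_max_right _ _)))⟩
  | disj φ ψ ih ih' =>
    obtain ⟨k, hk⟩ := ih
    obtain ⟨k', hk'⟩ := ih'
    exact ⟨max k k', fun w w' p p' h => or_congr (hk w w' p p' (h.of_le (le_max_left _ _)))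
      (hk' w w' p p' (h.of_le (le_max_right _ _)))⟩
  | ex i φ ih =>
    obtain ⟨k, hk⟩ := ih
    have key : ∀ w w' p p', SameType (k + 1) w w' p p' →
        (ex i φ).Sat w p → (ex i φ).Sat w' p' := by
      rintro w w' p p' h ⟨q, hq, hs⟩
      obtain ⟨q', hq', h'⟩ := h.exists_update i hq
      exact ⟨q', hq', (hk _ _ _ _ h').1 hs⟩
    exact ⟨k + 1, fun w w' p p' h => ⟨key _ _ _ _ h, key _ _ _ _ h.symm⟩⟩
  | all i φ ih =>
    obtain ⟨k, hk⟩ := ih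
    have key : ∀ w w' p p', SameType (k + 1) w w' p p' →
        (all i φ).Sat w p → (all i φ).Sat w' p' := by
      intro w w' p p' h hs q hq
      obtain ⟨q', hq', h'⟩ := h.symm.exists_update i hq
      exact (hk _ _ _ _ h').2 (hs q' hq')
    exact ⟨k + 1, fun w w' p p' h => ⟨key _ _ _ _ h, key _ _ _ _ h.symm⟩⟩

theorem FOFormula.sat_congr {k : ℕ} (φ : FOFormula A k) (w : List A) :
    ∀ p p' : Fin k → ℕ, (∀ i ∈ φ.freeVars, p i = p' i) → (φ.Sat w p ↔ φ.Sat w p') := by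
  induction φ with
  | tru => exact fun _ _ _ => Iff.rfl
  | fls => exact fun _ _ _ => Iff.rfl
  | label a i => intro p p' h; simp only [Sat]; rw [h i (by simp [freeVars])]
  | lt i j =>
    intro p p' h
    simp only [Sat]; rw [h i (by simp [freeVars]), h j (by simp [freeVars])]
  | eq i j =>
    intro p p' h
    simp only [Sat]; rw [h i (by simp [freeVars]), h j (by simp [freeVars])]
  | neg φ ih => exact fun p p' h => not_congr (ih p p' h)
  | conj φ ψ ih ih' =>
    exact fun p p' h => and_congr (ih p p' fun i hi => h i (Or.inl hi))
      (ih' p p' fun i hi => h i (Or.inr hi))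
  | disj φ ψ ih ih' =>
    exact fun p p' h => or_congr (ih p p' fun i hi => h i (Or.inl hi))
      (ih' p p' fun i hi => h i (Or.inr hi))
  | ex i φ ih =>
    refine fun p p' h => exists_congr fun q => and_congr_right fun _ => ih _ _ fun j hj => ?_
    by_cases hji : j = i
    · subst hji; simp
    · simpa [hji] using h j ⟨hj, hji⟩
  | all i φ ih =>
    refine fun p p' h => forall_congr' fun q => imp_congr_right fun _ => ih _ _ fun j hj => ?_
    by_cases hji : j = i
    · subst hji; simp
    · simpa [hji] using h j ⟨hj, hji⟩

theorem Language.IsFODefinable.exists_mem_iff {L : Language A} (h : L.IsFODefinable 2) :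
    ∃ k, ∀ w w' : List A, wordType k w = wordType k w' → (w ∈ L ↔ w' ∈ L) := by
  obtain ⟨φ, hφ, rfl⟩ := h
  obtain ⟨k, hk⟩ := φ.exists_sat_iff_of_sameType
  refine ⟨k, fun w w' hw => ?_⟩
  -- Both pointers are moved past the ends of both words. The whole word then lies to their left, so
  -- their types are governed by the word type, unlike the type of position `0`.
  have hfree : ∀ (v : List A) (n : ℕ), v ∈ φ.language ↔ φ.Sat v fun _ => n := fun v n =>
    φ.sat_congr v _ _ fun i hi => by rw [hφ] at hi; exact hi.elim
  rw [hfree w (max w.length w'.length), hfree w' (max w.length w'.length)]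
  refine hk _ _ _ _ ⟨fun _ => ?_, fun _ _ => by simp⟩
  have key : ∀ {w w' : List A} {n : ℕ}, w.length ≤ n → w'.length ≤ n →
      wordType k w = wordType k w' → positionType k w n = positionType k w' n := by
    intro w w' n hn hn' h
    have hlabel : w[n]? = w'[n]? := by
      rw [List.getElem?_eq_none hn, List.getElem?_eq_none hn']
    cases k with
    | zero => exact hlabel
    | succ k =>
      have forth : ∀ {w w' : List A}, w.length ≤ n → w'.length ≤ n →
          wordType k w = wordType k w' → Forth k w n w' n := by
        intro w w' hn hn' h
        refine ⟨fun j _ hl => ?_, fun j _ hl => by omega⟩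
        obtain ⟨j', h1, h2⟩ := (wordType_eq_iff.1 h).1 j hl
        exact ⟨j', by omega, h1, h2⟩
      have h' := wordType_eq_of_le k.le_succ h
      exact positionType_succ_eq_iff.2 ⟨hlabel, forth hn hn' h', forth hn' hn h'.symm⟩
  exact key (le_max_left _ _) (le_max_right _ _) hw

end Formulas

/-! ### Types are definable with two variables -/

section Definability

variable {A : Type u}

/-- The property `P` of pointed words is expressed by a two-variable formula with free variables
in `V`. -/
def IsExpressible (V : Set (Fin 2)) (P : List A → (Fin 2 → ℕ) → Prop) : Prop :=
  ∃ φ : FOFormula A 2, φ.freeVars ⊆ V ∧ ∀ w p, φ.Sat w p ↔ P w p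

variable {V : Set (Fin 2)} {P Q : List A → (Fin 2 → ℕ) → Prop}

theorem isExpressible_const (c : Prop) : IsExpressible V fun (_ : List A) _ => c := by
  by_cases hc : c
  · exact ⟨.tru, by simp [FOFormula.freeVars], fun _ _ => by simp [FOFormula.Sat, hc]⟩
  · exact ⟨.fls, by simp [FOFormula.freeVars], fun _ _ => by simp [FOFormula.Sat, hc]⟩

theorem IsExpressible.not (h : IsExpressible V P) : IsExpressible V fun w p => ¬ P w p := by
  obtain ⟨φ, h1, h2⟩ := h
  exact ⟨.neg φ, h1, fun w p => not_congr (h2 w p)⟩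

theorem IsExpressible.and (h : IsExpressible V P) (h' : IsExpressible V Q) :
    IsExpressible V fun w p => P w p ∧ Q w p := by
  obtain ⟨φ, h1, h2⟩ := h
  obtain ⟨ψ, h1', h2'⟩ := h'
  exact ⟨.conj φ ψ, Set.union_subset h1 h1', fun w p => and_congr (h2 w p) (h2' w p)⟩

theorem IsExpressible.forall {ι : Type*} [Finite ι] {P : ι → List A → (Fin 2 → ℕ) → Prop}
    (h : ∀ i, IsExpressible V (P i)) : IsExpressible V fun w p => ∀ i, P i w p := by
  have key : ∀ s : Set ι, s.Finite → IsExpressible V fun w p => ∀ i ∈ s, P i w p := by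
    intro s hs
    induction s, hs using Set.Finite.induction_on with
    | empty => simpa using isExpressible_const True
    | insert _ _ ih => simpa using (h _).and ih
  simpa using key Set.univ Set.finite_univ

theorem IsExpressible.exists {ι : Type*} [Finite ι] {P : ι → List A → (Fin 2 → ℕ) → Prop}
    (h : ∀ i, IsExpressible V (P i)) : IsExpressible V fun w p => ∃ i, P i w p := by
  simpa using (IsExpressible.forall fun i => (h i).not).not

theorem IsExpressible.iff_const (h : IsExpressible V P) (c : Prop) :
    IsExpressible V fun w p => P w p ↔ c := by
  by_cases hc : c
  · simpa [hc] using h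
  · simpa [hc] using h.not

theorem isExpressible_getElem?_eq [Finite A] (i : Fin 2) (o : Option A) :
    IsExpressible {i} fun (w : List A) p => w[p i]? = o := by
  have h : ∀ a : A, IsExpressible {i} fun (w : List A) p => w[p i]? = some a := fun a =>
    ⟨.label a i, by simp [FOFormula.freeVars], fun _ _ => Iff.rfl⟩
  cases o with
  | some a => exact h a
  | none => simpa [Option.eq_none_iff_forall_ne_some] using IsExpressible.forall fun a => (h a).not

theorem isExpressible_exists_lt {Q : List A → ℕ → Prop} {i j : Fin 2} (hij : j ≠ i)
    (h : IsExpressible {j} fun w p => Q w (p j)) :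
    IsExpressible {i} fun w p => ∃ q < p i, q < w.length ∧ Q w q := by
  obtain ⟨φ, h1, h2⟩ := h
  refine ⟨.ex j (.conj (.lt j i) φ), ?_, fun w p => ?_⟩
  · rintro l ⟨(rfl | rfl) | hl, hl'⟩
    · exact (hl' rfl).elim
    · rfl
    · exact (hl' (h1 hl)).elim
  · simp only [FOFormula.Sat, h2, Function.update_self, Function.update_of_ne hij.symm]
    exact exists_congr fun q => by tauto

theorem isExpressible_exists_gt {Q : List A → ℕ → Prop} {i j : Fin 2} (hij : j ≠ i)
    (h : IsExpressible {j} fun w p => Q w (p j)) :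
    IsExpressible {i} fun w p => ∃ q > p i, q < w.length ∧ Q w q := by
  obtain ⟨φ, h1, h2⟩ := h
  refine ⟨.ex j (.conj (.lt i j) φ), ?_, fun w p => ?_⟩
  · rintro l ⟨(rfl | rfl) | hl, hl'⟩
    · rfl
    · exact (hl' rfl).elim
    · exact (hl' (h1 hl)).elim
  · simp only [FOFormula.Sat, h2, Function.update_self, Function.update_of_ne hij.symm]
    exact exists_congr fun q => by tauto

theorem isExpressible_exists_position {Q : List A → ℕ → Prop} {j : Fin 2}
    (h : IsExpressible {j} fun w p => Q w (p j)) :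
    IsExpressible ∅ fun w _ => ∃ q < w.length, Q w q := by
  obtain ⟨φ, h1, h2⟩ := h
  refine ⟨.ex j φ, ?_, fun w p => by simp [FOFormula.Sat, h2]⟩
  rintro l ⟨hl, hl'⟩
  exact (hl' (h1 hl)).elim

/-- The type of lower depth is stated about the other variable, which the quantifier binds; the two
variables alternate with the depth. -/
theorem isExpressible_positionType_eq [Finite A] (k : ℕ) :
    ∀ (i : Fin 2) (t : RankType A k), IsExpressible {i} fun w p => positionType k w (p i) = t := by
  induction k with
  | zero => exact isExpressible_getElem?_eq
  | succ k ih =>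
    rintro i ⟨o, S, S'⟩
    obtain ⟨j, hj⟩ : ∃ j : Fin 2, j ≠ i := exists_ne i
    have h1 := IsExpressible.forall fun t =>
      (isExpressible_exists_lt (Q := fun w q => positionType k w q = t) hj (ih j t)).iff_const (t ∈ S)
    have h2 := IsExpressible.forall fun t =>
      (isExpressible_exists_gt (Q := fun w q => positionType k w q = t) hj (ih j t)).iff_const (t ∈ S')
    have h3 := (isExpressible_getElem?_eq i o).and (h1.and h2)
    convert h3 using 3 with w p
    exact Prod.mk_inj.trans (and_congr_right fun _ => Prod.mk_inj.trans
      (and_congr Set.ext_iff Set.ext_iff))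

/-- `L` is the union of the finitely many definable classes that meet it. -/
theorem isFODefinable_of_wordType [Finite A] {L : Language A} {k : ℕ}
    (h : ∀ w w' : List A, wordType k w = wordType k w' → (w ∈ L ↔ w' ∈ L)) :
    L.IsFODefinable 2 := by
  have h1 : ∀ S : Set (RankType A k), IsExpressible ∅ fun w _ => wordType k w = S := by
    intro S
    have := IsExpressible.forall fun t =>
      (isExpressible_exists_position (Q := fun w q => positionType k w q = t)
        (isExpressible_positionType_eq k 0 t)).iff_const (t ∈ S)
    convert this using 3 with w p
    exact Set.ext_iff
  obtain ⟨φ, hφ, hs⟩ := IsExpressible.exists fun S =>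
    (h1 S).and (isExpressible_const (∃ v ∈ L, wordType k v = S))
  refine ⟨φ, Set.subset_empty_iff.1 hφ, ?_⟩
  ext w
  refine (hs w _).trans ⟨?_, fun hw => ⟨_, rfl, w, hw, rfl⟩⟩
  rintro ⟨S, rfl, v, hv, h2⟩
  exact (h _ _ h2).1 hv

end Definability

/-! ### The quotient by word types lies in DA -/

section Pumping

variable {A : Type u}

theorem exists_getElem?_flatten_replicate {p : List A} {a : A} (ha : a ∈ p) {k K : ℕ}
    (hk : k < K) : ∃ j, k * p.length ≤ j ∧ j < (k + 1) * p.length ∧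
      (List.replicate K p).flatten[j]? = some a := by
  obtain ⟨j, hj⟩ := List.mem_iff_getElem?.1 ha
  have hjl := (List.getElem?_eq_some_iff.1 hj).1
  obtain ⟨m, rfl⟩ := Nat.exists_eq_add_of_lt hk
  refine ⟨k * p.length + j, by omega, by rw [add_mul]; omega, ?_⟩
  rw [add_assoc, ← List.replicate_append_replicate, List.flatten_append,
    List.getElem?_append_right (by simp), List.replicate_succ, List.flatten_cons,
    List.getElem?_append_left (by simpa using hjl)]
  simpa using hj

/-- Words that begin and end with `p ^ K` and contain no letters outside `p`. -/
def IsPumped (p : List A) (K : ℕ) (w : List A) : Prop :=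
  ∃ m, w = (List.replicate K p).flatten ++ m ++ (List.replicate K p).flatten ∧ ∀ a ∈ m, a ∈ p

namespace IsPumped

variable {p w : List A} {K : ℕ}

theorem length_le (h : IsPumped p K w) : 2 * (K * p.length) ≤ w.length := by
  obtain ⟨m, rfl, -⟩ := h
  simp
  omega

theorem getElem?_left (h : IsPumped p K w) {i : ℕ} (hi : i < K * p.length) :
    w[i]? = (List.replicate K p).flatten[i]? := by
  obtain ⟨m, rfl, -⟩ := h
  rw [List.append_assoc, List.getElem?_append_left (by simpa using hi)]

theorem getElem?_right (h : IsPumped p K w) {i j : ℕ} (hi : j + w.length = i + K * p.length) :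
    w[i]? = (List.replicate K p).flatten[j]? := by
  obtain ⟨m, rfl, -⟩ := h
  simp at hi
  rw [List.getElem?_append_right (by simp; omega)]
  congr 1
  simp
  omega

theorem exists_mem_getElem? (h : IsPumped p K w) {i : ℕ} (hi : i < w.length) :
    ∃ a ∈ p, w[i]? = some a := by
  have hmem : ∀ a ∈ w, a ∈ p := by
    obtain ⟨m, rfl, hm⟩ := h
    have : ∀ a ∈ (List.replicate K p).flatten, a ∈ p := by
      intro a ha
      obtain ⟨l, hl, hal⟩ := List.mem_flatten.1 ha
      rwa [List.eq_of_mem_replicate hl] at hal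
    intro a ha
    rcases List.mem_append.1 ha with ha | ha
    · rcases List.mem_append.1 ha with ha | ha
      · exact this a ha
      · exact hm a ha
    · exact this a ha
  exact ⟨w[i], hmem _ (List.getElem_mem hi), List.getElem?_eq_getElem hi⟩

end IsPumped

/-- The second player copies moves near the ends of the words, and answers the other moves
far away from the ends. -/
def PumpGame (p : List A) (K k : ℕ) (w : List A) (i : ℕ) (w' : List A) (i' : ℕ) : Prop :=
  k ≤ K ∧ IsPumped p K w ∧ IsPumped p K w' ∧ w[i]? = w'[i']? ∧ i < w.length ∧ i' < w'.length ∧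
    ((i < K * p.length ∧ i = i') ∨
      (w.length ≤ i + K * p.length ∧ i + w'.length = i' + w.length) ∨
      (k * p.length ≤ i ∧ i + k * p.length < w.length ∧
        k * p.length ≤ i' ∧ i' + k * p.length < w'.length))

namespace PumpGame

variable {p w w' : List A} {K k i i' j : ℕ}

theorem copy_left (hk : k ≤ K) (h : IsPumped p K w) (h' : IsPumped p K w')
    (hj : j < K * p.length) : j < w'.length ∧ PumpGame p K k w j w' j := by
  have := h.length_le
  have := h'.length_le
  exact ⟨by omega, hk, h, h', by rw [h.getElem?_left hj, h'.getElem?_left hj], by omega, by omega,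
    Or.inl ⟨hj, rfl⟩⟩

theorem copy_right (hk : k ≤ K) (h : IsPumped p K w) (h' : IsPumped p K w')
    (hj : w.length ≤ j + K * p.length) (hjl : j < w.length) :
    ∃ j' < w'.length, j + w'.length = j' + w.length ∧ PumpGame p K k w j w' j' := by
  have := h.length_le
  have := h'.length_le
  obtain ⟨i, hi⟩ := Nat.exists_eq_add_of_le hj
  refine ⟨j + w'.length - w.length, by omega, by omega, hk, h, h', ?_, hjl, by omega,
    Or.inr (Or.inl ⟨hj, by omega⟩)⟩
  rw [h.getElem?_right (j := i) (by omega), h'.getElem?_right (j := i) (by omega)]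

/-- The reply is a position with the same letter in block number `k` of the left end: still `k`
blocks deep, but to the left of anything `k + 1` blocks deep. Each round costs one block. -/
theorem middle_left (hk : k + 1 ≤ K) (h : IsPumped p K w) (h' : IsPumped p K w')
    (hj : k * p.length ≤ j) (hj' : j + k * p.length < w.length) :
    ∃ j' < (k + 1) * p.length, j' < w'.length ∧ PumpGame p K k w j w' j' := by
  have h1 := h.length_le
  have h2 := h'.length_le
  have h3 : (k + 1) * p.length ≤ K * p.length := Nat.mul_le_mul_right _ hk
  have h4 : k * p.length ≤ (k + 1) * p.length := Nat.mul_le_mul_right _ k.le_succ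
  obtain ⟨a, ha, hja⟩ := h.exists_mem_getElem? (i := j) (by omega)
  obtain ⟨j', h5, h6, h7⟩ := exists_getElem?_flatten_replicate ha (Nat.lt_of_succ_le hk)
  exact ⟨j', h6, by omega, by omega, h, h', by rw [hja, h'.getElem?_left (by omega), h7],
    by omega, by omega, Or.inr (Or.inr ⟨hj, hj', h5, by omega⟩)⟩

theorem middle_right (hk : k + 1 ≤ K) (h : IsPumped p K w) (h' : IsPumped p K w')
    (hj : k * p.length ≤ j) (hj' : j + k * p.length < w.length) :
    ∃ j' < w'.length, w'.length ≤ j' + (k + 1) * p.length ∧ PumpGame p K k w j w' j' := by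
  have h1 := h.length_le
  have h2 := h'.length_le
  have h3 : (k + 1) * p.length ≤ K * p.length := Nat.mul_le_mul_right _ hk
  have h4 : k * p.length ≤ (k + 1) * p.length := Nat.mul_le_mul_right _ k.le_succ
  obtain ⟨a, ha, hja⟩ := h.exists_mem_getElem? (i := j) (by omega)
  obtain ⟨m, rfl⟩ := Nat.exists_eq_add_of_le hk
  obtain ⟨j', h5, h6, h7⟩ := exists_getElem?_flatten_replicate ha
    (show m < k + 1 + m by omega)
  simp only [add_mul, one_mul] at *
  refine ⟨w'.length + j' - (k * p.length + p.length + m * p.length), by omega, by omega, by omega,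
    h, h', ?_, by omega, by omega, Or.inr (Or.inr ⟨hj, hj', by omega, by omega⟩)⟩
  rw [hja, h'.getElem?_right (j := j') (by simp only [add_mul, one_mul]; omega), h7]

theorem symm (h : PumpGame p K k w i w' i') : PumpGame p K k w' i' w i := by
  obtain ⟨h1, h2, h3, h4, h5, h6, h⟩ := h
  have := h2.length_le
  have := h3.length_le
  exact ⟨h1, h3, h2, h4.symm, h6, h5, by omega⟩

theorem positionType_eq (h : PumpGame p K k w i w' i') :
    positionType k w i = positionType k w' i' := by
  refine positionType_eq_of_game (PumpGame p K) symm (fun h => h.2.2.2.1) ?_ ?_ h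
  · rintro k w i w' i' ⟨h1, h2, h3, -, h5, h6, h⟩ j hj hl
    have h7 := h2.length_le
    have h8 := h3.length_le
    have h9 : (k + 1) * p.length ≤ K * p.length := Nat.mul_le_mul_right _ h1
    have h10 : k * p.length ≤ (k + 1) * p.length := Nat.mul_le_mul_right _ k.le_succ
    rcases lt_or_ge j (K * p.length) with hjl | hjl
    · rcases lt_or_ge j i' with hji | hji
      · obtain ⟨h11, h12⟩ := copy_left (k := k) (by omega) h2 h3 hjl
        exact ⟨j, hji, h11, h12⟩
      -- Here `i' ≤ j < i`, which excludes copied positions: `i` and `i'` are both `k + 1` blocks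
      -- away from the ends.
      · obtain ⟨j', h11, h12, h13⟩ := middle_left (j := j) h1 h2 h3 (by omega) (by omega)
        exact ⟨j', by omega, h12, h13⟩
    · rcases lt_or_ge (j + K * p.length) w.length with hjr | hjr
      · obtain ⟨j', h11, h12, h13⟩ := middle_left (j := j) h1 h2 h3 (by omega) (by omega)
        exact ⟨j', by omega, h12, h13⟩
      · by_cases hm : i + w'.length = i' + w.length
        · obtain ⟨j', h11, h12, h13⟩ := copy_right (k := k) (by omega) h2 h3 hjr hl
          exact ⟨j', by omega, h11, h13⟩
        · obtain ⟨j', h11, h12, h13⟩ := middle_left (j := j) h1 h2 h3 (by omega) (by omega)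
          exact ⟨j', by omega, h12, h13⟩
  · rintro k w i w' i' ⟨h1, h2, h3, -, h5, h6, h⟩ j hj hl
    have h7 := h2.length_le
    have h8 := h3.length_le
    have h9 : (k + 1) * p.length ≤ K * p.length := Nat.mul_le_mul_right _ h1
    have h10 : k * p.length ≤ (k + 1) * p.length := Nat.mul_le_mul_right _ k.le_succ
    rcases lt_or_ge (j + K * p.length) w.length with hjr | hjr
    · rcases lt_or_ge j (K * p.length) with hjl | hjl
      · by_cases hm : i = i'
        · obtain ⟨h11, h12⟩ := copy_left (k := k) (by omega) h2 h3 hjl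
          exact ⟨j, by omega, h11, h12⟩
        · obtain ⟨j', h11, h12, h13⟩ := middle_right (j := j) h1 h2 h3 (by omega) (by omega)
          exact ⟨j', by omega, h11, h13⟩
      · obtain ⟨j', h11, h12, h13⟩ := middle_right (j := j) h1 h2 h3 (by omega) (by omega)
        exact ⟨j', by omega, h11, h13⟩
    · obtain ⟨j', h11, h12, h13⟩ := copy_right (k := k) (by omega) h2 h3 hjr hl
      rcases lt_or_ge i' j' with hji | hji
      · exact ⟨j', hji, h11, h13⟩
      · obtain ⟨j', h11, h12, h13⟩ := middle_right (j := j) h1 h2 h3 (by omega) (by omega)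
        exact ⟨j', by omega, h11, h13⟩

end PumpGame

/-- The block beyond `k` pays for the initial choice of a position, before the `k` rounds. -/
theorem wordType_eq_of_isPumped {p w w' : List A} {k : ℕ} (h : IsPumped p (k + 1) w)
    (h' : IsPumped p (k + 1) w') : wordType k w = wordType k w' := by
  have key : ∀ {w w' : List A}, IsPumped p (k + 1) w → IsPumped p (k + 1) w' →
      ∀ j < w.length, ∃ j' < w'.length, positionType k w j = positionType k w' j' := by
    intro w w' h h' j hj
    rcases lt_or_ge j ((k + 1) * p.length) with hjl | hjl
    · obtain ⟨h1, h2⟩ := PumpGame.copy_left k.le_succ h h' hjl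
      exact ⟨j, h1, h2.positionType_eq⟩
    · have h10 : k * p.length ≤ (k + 1) * p.length := Nat.mul_le_mul_right _ k.le_succ
      rcases lt_or_ge (j + (k + 1) * p.length) w.length with hjr | hjr
      · obtain ⟨j', -, h1, h2⟩ := PumpGame.middle_left (j := j) le_rfl h h' (by omega) (by omega)
        exact ⟨j', h1, h2.positionType_eq⟩
      · obtain ⟨j', h1, -, h2⟩ := PumpGame.copy_right k.le_succ h h' hjr hj
        exact ⟨j', h1, h2.positionType_eq⟩
  exact wordType_eq_iff.2 ⟨key h h', key h' h⟩

theorem toList_pow_eq_flatten_replicate (x : FreeMonoid A) (n : ℕ) :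
    FreeMonoid.toList (x ^ n) = (List.replicate n (FreeMonoid.toList x)).flatten := by
  induction n with
  | zero => rfl
  | succ n ih => rw [pow_succ', FreeMonoid.toList_mul, ih, List.replicate_succ, List.flatten_cons]

theorem wordTypeCon_pow_mul_mul_pow (k : ℕ) {x z z' : FreeMonoid A}
    (hz : ∀ a ∈ FreeMonoid.toList z, a ∈ FreeMonoid.toList x)
    (hz' : ∀ a ∈ FreeMonoid.toList z', a ∈ FreeMonoid.toList x) :
    wordTypeCon A k (x ^ (k + 1) * z * x ^ (k + 1)) (x ^ (k + 1) * z' * x ^ (k + 1)) := by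
  refine wordType_eq_of_isPumped (p := FreeMonoid.toList x) ⟨FreeMonoid.toList z, ?_, hz⟩
    ⟨FreeMonoid.toList z', ?_, hz'⟩ <;>
  simp only [FreeMonoid.toList_mul, toList_pow_eq_flatten_replicate]

theorem mem_toList_of_mem_pow {x : FreeMonoid A} {n : ℕ} {a : A}
    (ha : a ∈ FreeMonoid.toList (x ^ n)) : a ∈ FreeMonoid.toList x := by
  rw [toList_pow_eq_flatten_replicate] at ha
  obtain ⟨l, hl, hal⟩ := List.mem_flatten.1 ha
  rwa [List.eq_of_mem_replicate hl] at hal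

theorem inDA_wordTypeCon_quotient (A : Type u) [Finite A] (k : ℕ) :
    InDA (wordTypeCon A k).Quotient := by
  -- The exponent is split around an empty middle, so both identities amount to replacing one middle
  -- by another.
  have hmul : ∀ x : FreeMonoid A, x ^ (2 * (k + 1)) = x ^ (k + 1) * 1 * x ^ (k + 1) := fun x => by
    rw [mul_one, two_mul, pow_add]
  refine ⟨finite_wordTypeCon_quotient A k, 2 * (k + 1), ⟨by omega, ?_⟩, ?_⟩
  · rintro ⟨x⟩
    have h := wordTypeCon_pow_mul_mul_pow k (x := x) (z := x ^ (k + 1) * x ^ (k + 1)) (z' := 1)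
      (fun a ha => by
        rw [← pow_add] at ha
        exact mem_toList_of_mem_pow ha) (fun a ha => by simp at ha)
    refine ((wordTypeCon A k).eq.2 ?_ :
      ((x ^ (2 * (k + 1)) * x ^ (2 * (k + 1)) : FreeMonoid A) : (wordTypeCon A k).Quotient) =
        (x ^ (2 * (k + 1)) : FreeMonoid A))
    rw [hmul]
    simpa only [mul_one, mul_assoc] using h
  · rintro ⟨x⟩ ⟨y⟩
    have h := wordTypeCon_pow_mul_mul_pow k (x := x * y)
      (z := (x * y) ^ (k + 1) * y * (x * y) ^ (k + 1)) (z' := 1)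
      (fun a ha => by
        simp only [FreeMonoid.toList_mul, List.mem_append] at ha
        rcases ha with (ha | ha) | ha
        · exact mem_toList_of_mem_pow ha
        · simp [ha]
        · exact mem_toList_of_mem_pow ha) (fun a ha => by simp at ha)
    refine ((wordTypeCon A k).eq.2 ?_ :
      (((x * y) ^ (2 * (k + 1)) * y * (x * y) ^ (2 * (k + 1)) : FreeMonoid A) :
        (wordTypeCon A k).Quotient) = ((x * y) ^ (2 * (k + 1)) : FreeMonoid A))
    rw [hmul]
    simpa only [mul_one, mul_assoc] using h

end Pumping

/-! ### Cutting a word at the first or last occurrence of a letter -/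

section Factors

variable {A : Type u} {k : ℕ}

/-- The types of the positions of `x ++ y ++ z` and `x' ++ y' ++ z'` tell whether a position
belongs to the factor `y` respectively `y'`. -/
def SameRegion (x y z x' y' z' : List A) : Prop :=
  ∀ p p', positionType 1 (x ++ y ++ z) p = positionType 1 (x' ++ y' ++ z') p' →
    p < (x ++ y ++ z).length → p' < (x' ++ y' ++ z').length →
    ((x.length ≤ p ∧ p < x.length + y.length) ↔ (x'.length ≤ p' ∧ p' < x'.length + y'.length))

/-- The second player plays on the factors as in the whole words. -/
def FactorGame (k : ℕ) (y : List A) (i : ℕ) (y' : List A) (i' : ℕ) : Prop :=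
  ∃ x z x' z', i < y.length ∧ i' < y'.length ∧ SameRegion x y z x' y' z' ∧
    positionType (k + 1) (x ++ y ++ z) (x.length + i) =
      positionType (k + 1) (x' ++ y' ++ z') (x'.length + i')

/-- Replies are taken in the whole words. The extra level of depth leaves depth at least 1 after
each round, enough to see that the reply stays in the factor. -/
theorem FactorGame.positionType_eq {y y' : List A} {i i' : ℕ} (h : FactorGame k y i y' i') :
    positionType k y i = positionType k y' i' := by
  have getElem?_eq : ∀ {x y z : List A} {i : ℕ}, i < y.length →
      (x ++ y ++ z)[x.length + i]? = y[i]? := by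
    intro x y z i hi
    rw [List.append_assoc, List.getElem?_append_right (by omega), Nat.add_sub_cancel_left,
      List.getElem?_append_left hi]
  refine positionType_eq_of_game FactorGame ?_ ?_ ?_ ?_ h
  · rintro k y i y' i' ⟨x, z, x', z', h1, h2, h3, h4⟩
    exact ⟨x', z', x, z, h2, h1, fun p p' h h5 h6 => (h3 p' p h.symm h6 h5).symm, h4.symm⟩
  · rintro k y i y' i' ⟨x, z, x', z', h1, h2, h3, h4⟩
    rw [← getElem?_eq h1, ← getElem?_eq h2]
    exact getElem?_eq_of_positionType_eq h4
  · rintro k y i y' i' ⟨x, z, x', z', h1, h2, h3, h4⟩ j hj hl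
    obtain ⟨j', h5, h6, h7⟩ := (positionType_succ_eq_iff.1 h4).2.1.1 (x.length + j) (by omega)
      (by simp; omega)
    have h8 := (h3 _ _ (positionType_eq_of_le (by omega) h7) (by simp; omega) h6).1
      ⟨by omega, by omega⟩
    obtain ⟨j', rfl⟩ := Nat.exists_eq_add_of_le h8.1
    exact ⟨j', by omega, by omega, x, z, x', z', hl, by omega, h3, h7⟩
  · rintro k y i y' i' ⟨x, z, x', z', h1, h2, h3, h4⟩ j hj hl
    obtain ⟨j', h5, h6, h7⟩ := (positionType_succ_eq_iff.1 h4).2.1.2 (x.length + j) (by omega)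
      (by simp; omega)
    have h8 := (h3 _ _ (positionType_eq_of_le (by omega) h7) (by simp; omega) h6).1
      ⟨by omega, by omega⟩
    obtain ⟨j', rfl⟩ := Nat.exists_eq_add_of_le h8.1
    exact ⟨j', by omega, by omega, x, z, x', z', hl, by omega, h3, h7⟩

theorem SameRegion.wordType_eq {x y z x' y' z' : List A} (h : SameRegion x y z x' y' z')
    (hw : wordType (k + 1) (x ++ y ++ z) = wordType (k + 1) (x' ++ y' ++ z')) :
    wordType k y = wordType k y' := by
  have key : ∀ {x y z x' y' z' : List A}, SameRegion x y z x' y' z' →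
      wordType (k + 1) (x ++ y ++ z) = wordType (k + 1) (x' ++ y' ++ z') →
      ∀ j < y.length, ∃ j' < y'.length, positionType k y j = positionType k y' j' := by
    intro x y z x' y' z' h hw j hj
    obtain ⟨j', h1, h2⟩ := (wordType_eq_iff.1 hw).1 (x.length + j) (by simp; omega)
    have h3 := (h _ _ (positionType_eq_of_le (by omega) h2) (by simp; omega) h1).1
      ⟨by omega, by omega⟩
    obtain ⟨j', rfl⟩ := Nat.exists_eq_add_of_le h3.1
    exact ⟨j', by omega,
      FactorGame.positionType_eq ⟨x, z, x', z', hj, by omega, h, h2⟩⟩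
  exact wordType_eq_iff.2 ⟨key h hw, key (fun p p' h1 h2 h3 => (h p' p h1.symm h3 h2).symm) hw.symm⟩

variable {w w' : List A} {i i' : ℕ}

theorem exists_lt_getElem?_iff (h : positionType 1 w i = positionType 1 w' i') (a : A) :
    (∃ j < i, w[j]? = some a) ↔ ∃ j < i', w'[j]? = some a := by
  have key : ∀ {w w' : List A} {i i' : ℕ}, positionType 1 w i = positionType 1 w' i' →
      (∃ j < i, w[j]? = some a) → ∃ j < i', w'[j]? = some a := by
    rintro w w' i i' h ⟨j, hj, hja⟩
    obtain ⟨j', h1, -, h3⟩ := (positionType_succ_eq_iff.1 h).2.1.1 j hj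
      (List.getElem?_eq_some_iff.1 hja).1
    exact ⟨j', h1, h3.symm.trans hja⟩
  exact ⟨key h, key h.symm⟩

theorem exists_gt_getElem?_iff (h : positionType 1 w i = positionType 1 w' i') (a : A) :
    (∃ j > i, w[j]? = some a) ↔ ∃ j > i', w'[j]? = some a := by
  have key : ∀ {w w' : List A} {i i' : ℕ}, positionType 1 w i = positionType 1 w' i' →
      (∃ j > i, w[j]? = some a) → ∃ j > i', w'[j]? = some a := by
    rintro w w' i i' h ⟨j, hj, hja⟩
    obtain ⟨j', h1, -, h3⟩ := (positionType_succ_eq_iff.1 h).2.1.2 j hj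
      (List.getElem?_eq_some_iff.1 hja).1
    exact ⟨j', h1, h3.symm.trans hja⟩
  exact ⟨key h, key h.symm⟩

theorem getElem?_append_cons_length (u₀ u₁ : List A) (a : A) :
    (u₀ ++ a :: u₁)[u₀.length]? = some a := by
  simp

theorem length_le_of_getElem?_eq_some {u₀ u₁ : List A} {a : A} (ha : a ∉ u₀) {j : ℕ}
    (hj : (u₀ ++ a :: u₁)[j]? = some a) : u₀.length ≤ j := by
  by_contra! hlt
  rw [List.getElem?_append_left hlt] at hj
  exact ha (List.mem_of_getElem? hj)

theorem le_length_of_getElem?_eq_some {u₀ u₁ : List A} {a : A} (ha : a ∉ u₁) {j : ℕ}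
    (hj : (u₀ ++ a :: u₁)[j]? = some a) : j ≤ u₀.length := by
  by_contra! hlt
  obtain ⟨m, rfl⟩ := Nat.exists_eq_add_of_lt hlt
  rw [List.getElem?_append_right (by omega)] at hj
  simp only [add_assoc, Nat.add_sub_cancel_left, List.getElem?_cons_succ] at hj
  exact ha (List.mem_of_getElem? hj)

theorem length_lt_iff_exists {u₀ u₁ : List A} {a : A} (ha : a ∉ u₀) (i : ℕ) :
    u₀.length < i ↔ ∃ j < i, (u₀ ++ a :: u₁)[j]? = some a :=
  ⟨fun h => ⟨_, h, getElem?_append_cons_length _ _ _⟩,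
    fun ⟨_, h1, h2⟩ => (length_le_of_getElem?_eq_some ha h2).trans_lt h1⟩

theorem lt_length_iff_exists {u₀ u₁ : List A} {a : A} (ha : a ∉ u₁) (i : ℕ) :
    i < u₀.length ↔ ∃ j > i, (u₀ ++ a :: u₁)[j]? = some a :=
  ⟨fun h => ⟨_, h, getElem?_append_cons_length _ _ _⟩,
    fun ⟨_, h1, h2⟩ => h1.trans_le (le_length_of_getElem?_eq_some ha h2)⟩

theorem length_le_iff_exists {u₀ u₁ : List A} {a : A} (ha : a ∉ u₀) (i : ℕ) :
    u₀.length ≤ i ↔ (u₀ ++ a :: u₁)[i]? = some a ∨ u₀.length < i := by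
  constructor
  · intro h
    rcases h.eq_or_lt with rfl | h
    · exact Or.inl (getElem?_append_cons_length _ _ _)
    · exact Or.inr h
  · rintro (h | h)
    · exact length_le_of_getElem?_eq_some ha h
    · exact h.le

theorem le_length_iff_exists {u₀ u₁ : List A} {a : A} (ha : a ∉ u₁) (i : ℕ) :
    i ≤ u₀.length ↔ (u₀ ++ a :: u₁)[i]? = some a ∨ i < u₀.length := by
  constructor
  · intro h
    rcases h.eq_or_lt with rfl | h
    · exact Or.inl (getElem?_append_cons_length _ _ _)
    · exact Or.inr h
  · rintro (h | h)
    · exact le_length_of_getElem?_eq_some ha h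
    · exact h.le

theorem wordType_eq_of_append_cons {u₀ u₁ v₀ v₁ : List A} {a : A}
    (hlt : ∀ i i', positionType 1 (u₀ ++ a :: u₁) i = positionType 1 (v₀ ++ a :: v₁) i' →
      (i < u₀.length ↔ i' < v₀.length))
    (hgt : ∀ i i', positionType 1 (u₀ ++ a :: u₁) i = positionType 1 (v₀ ++ a :: v₁) i' →
      (u₀.length < i ↔ v₀.length < i'))
    (h : wordType (k + 1) (u₀ ++ a :: u₁) = wordType (k + 1) (v₀ ++ a :: v₁)) :
    wordType k u₀ = wordType k v₀ ∧ wordType k u₁ = wordType k v₁ := by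
  constructor
  · refine SameRegion.wordType_eq (x := []) (z := a :: u₁) (x' := []) (z' := a :: v₁) ?_ h
    intro p p' h _ _
    simpa using hlt p p' h
  · refine SameRegion.wordType_eq (x := u₀ ++ [a]) (z := []) (x' := v₀ ++ [a]) (z' := []) ?_
      (by simpa using h)
    intro p p' h h1 h2
    have := hgt p p' (by simpa using h)
    simp at h1 h2 ⊢
    omega

/-- With `v` also cut at its first `a`, being after the cut means having an `a` to the left, and
being at the cut or after it means carrying `a` or being after it. Depth 1 sees both. -/
theorem exists_first_factorization {u₀ u₁ v : List A} {a : A} (ha : a ∉ u₀)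
    (h : wordType (k + 1) (u₀ ++ a :: u₁) = wordType (k + 1) v) :
    ∃ v₀ v₁, v = v₀ ++ a :: v₁ ∧ wordType k u₀ = wordType k v₀ ∧
      wordType k u₁ = wordType k v₁ := by
  obtain ⟨v₀, v₁, rfl, hv⟩ :=
    List.eq_append_cons_of_mem ((mem_iff_of_wordType_eq h a).1 (by simp))
  have hgt : ∀ i i', positionType 1 (u₀ ++ a :: u₁) i = positionType 1 (v₀ ++ a :: v₁) i' →
      (u₀.length < i ↔ v₀.length < i') := fun i i' hi => by
    rw [length_lt_iff_exists (u₁ := u₁) ha, length_lt_iff_exists (u₁ := v₁) hv,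
      exists_lt_getElem?_iff hi]
  refine ⟨v₀, v₁, rfl, wordType_eq_of_append_cons (fun i i' hi => ?_) hgt h⟩
  rw [← not_le, ← not_le, length_le_iff_exists (u₁ := u₁) ha, length_le_iff_exists (u₁ := v₁) hv,
    getElem?_eq_of_positionType_eq hi, hgt i i' hi]

theorem exists_eq_append_cons_notMem {v : List A} {a : A} (h : a ∈ v) :
    ∃ v₀ v₁, v = v₀ ++ a :: v₁ ∧ a ∉ v₁ := by
  obtain ⟨l, l', h1, h2⟩ := List.eq_append_cons_of_mem (List.mem_reverse.2 h)
  refine ⟨l'.reverse, l.reverse, ?_, by simpa using h2⟩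
  rw [← List.reverse_reverse v, h1]
  simp

theorem exists_last_factorization {u₀ u₁ v : List A} {a : A} (ha : a ∉ u₁)
    (h : wordType (k + 1) (u₀ ++ a :: u₁) = wordType (k + 1) v) :
    ∃ v₀ v₁, v = v₀ ++ a :: v₁ ∧ wordType k u₀ = wordType k v₀ ∧
      wordType k u₁ = wordType k v₁ := by
  obtain ⟨v₀, v₁, rfl, hv⟩ :=
    exists_eq_append_cons_notMem ((mem_iff_of_wordType_eq h a).1 (by simp))
  have hlt : ∀ i i', positionType 1 (u₀ ++ a :: u₁) i = positionType 1 (v₀ ++ a :: v₁) i' →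
      (i < u₀.length ↔ i' < v₀.length) := fun i i' hi => by
    rw [lt_length_iff_exists (u₁ := u₁) ha, lt_length_iff_exists (u₁ := v₁) hv,
      exists_gt_getElem?_iff hi]
  refine ⟨v₀, v₁, rfl, wordType_eq_of_append_cons hlt (fun i i' hi => ?_) h⟩
  rw [← not_le, ← not_le, le_length_iff_exists (u₁ := u₁) ha, le_length_iff_exists (u₁ := v₁) hv,
    getElem?_eq_of_positionType_eq hi, hlt i i' hi]

end Factors

/-! ### Idempotents and divisibility in DA -/

section Algebra

variable {M : Type*} [Monoid M]

theorem InDA.mul_suffix_mul (hM : InDA M) {e a s : M} (he : e * e = e) (h : e = a * s) :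
    e * s * e = e := by
  obtain ⟨-, n, ⟨hn, -⟩, h1⟩ := hM
  have h2 := h1 a s
  obtain ⟨m, rfl⟩ := Nat.exists_eq_add_of_le' hn
  rwa [← h, IsIdempotentElem.pow_succ_eq m he] at h2

/-- The defining identity treats suffixes only. It is applied to the conjugate idempotent `b * e *
s`, which has `e * s` as a suffix, and the result is multiplied by `s` on the left and `b` on the
right. -/
theorem InDA.mul_prefix_mul (hM : InDA M) {e s b : M} (he : e * e = e) (h : e = s * b) :
    e * s * e = e := by
  have h1 : (b * e * s) * (b * e * s) = b * e * s := by
    calc (b * e * s) * (b * e * s) = b * (e * (s * b) * e) * s := by simp only [mul_assoc]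
      _ = b * e * s := by rw [← h, he, he]
  have h2 := hM.mul_suffix_mul (a := b * e) (s := e * s) h1 (by
    rw [mul_assoc b e (e * s), ← mul_assoc e e s, he, mul_assoc])
  calc e * s * e = (s * b) * e * s * e * (s * b) * (e * (s * b)) := by
        rw [← h]; simp only [he, mul_assoc]
    _ = s * (b * e * s * (e * s) * (b * e * s)) * b := by simp only [mul_assoc]
    _ = (s * b) * e * (s * b) := by rw [h2]; simp only [mul_assoc]
    _ = e := by rw [← h, he, he]

theorem InDA.mul_factor_mul (hM : InDA M) {e a s b : M} (he : e * e = e) (h : e = a * s * b) :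
    e * s * e = e := by
  have h1 : e * (s * b) * e = e := hM.mul_suffix_mul he (by rw [h, mul_assoc])
  -- By `h1`, `e * s` is itself a prefix of `e`.
  have h2 := hM.mul_prefix_mul (s := e * s) (b := b * e) he (by
    simp only [mul_assoc] at h1 ⊢
    exact h1.symm)
  rwa [← mul_assoc, he] at h2

theorem InDA.exists_pow_factor (hM : InDA M) {c x b y : M} (hc : c = x * b * y) :
    ∃ n, c ^ n * b * c ^ n = c ^ n := by
  obtain ⟨-, n, ⟨hn, hidem⟩, -⟩ := id hM
  obtain ⟨m, rfl⟩ := Nat.exists_eq_add_of_le' hn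
  exact ⟨m + 1, hM.mul_factor_mul (a := x) (b := y * c ^ m) (hidem c) (by
    rw [pow_succ', ← mul_assoc, ← hc])⟩

theorem InDA.mul_dvd_of_mul_eq (hM : InDA M) {t c x b y : M} (ht : t * c = t)
    (hc : c = x * b * y) : t * b ∣ t := by
  obtain ⟨n, hn⟩ := hM.exists_pow_factor hc
  have h : t * c ^ n = t := by
    clear hn
    induction n with
    | zero => simp
    | succ n ih => rw [pow_succ, ← mul_assoc, ih, ht]
  refine ⟨c ^ n, ?_⟩
  calc t = t * (c ^ n * b * c ^ n) := by rw [hn, h]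
    _ = t * b * c ^ n := by rw [← mul_assoc, ← mul_assoc, h]

theorem InDA.exists_mul_mul_eq (hM : InDA M) {t c x b y : M} (ht : c * t = t)
    (hc : c = x * b * y) : ∃ z, t = z * (b * t) := by
  obtain ⟨n, hn⟩ := hM.exists_pow_factor hc
  have h : c ^ n * t = t := by
    clear hn
    induction n with
    | zero => simp
    | succ n ih => rw [pow_succ, mul_assoc, ht, ih]
  refine ⟨c ^ n, ?_⟩
  calc t = (c ^ n * b * c ^ n) * t := by rw [hn, h]
    _ = c ^ n * (b * t) := by rw [mul_assoc, h, mul_assoc]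

theorem InDA.exists_pow_succ_eq (hM : InDA M) : ∃ n, ∀ y : M, y ^ n * y = y ^ n := by
  obtain ⟨-, n, ⟨-, hidem⟩, h⟩ := hM
  refine ⟨n, fun y => ?_⟩
  have h1 := h 1 y
  have h2 : y ^ n * y ^ n = y ^ n := hidem y
  rwa [one_mul, mul_assoc, (Commute.self_pow y n).eq, ← mul_assoc, h2] at h1

/-- From `s = y * s * x` follows `s = y ^ n * s * x ^ n`; since `y ^ n` absorbs `y`, also `y * s =
s`, and then `s = s * x = t`. -/
theorem InDA.eq_of_dvd (hM : InDA M) {s t y : M} (h : s ∣ t) (hy : s = y * t) : s = t := by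
  obtain ⟨x, hx⟩ := h
  obtain ⟨n, hn⟩ := hM.exists_pow_succ_eq
  have h1 : s = y * s * x := by rw [mul_assoc, ← hx, ← hy]
  have h2 : ∀ m, s = y ^ m * s * x ^ m := by
    intro m
    induction m with
    | zero => simp
    | succ m ih =>
      calc s = y * (y ^ m * s * x ^ m) * x := by rw [← ih, ← h1]
        _ = y ^ (m + 1) * s * x ^ (m + 1) := by rw [pow_succ', pow_succ]; simp only [mul_assoc]
  have h3 : y * s = s := by
    calc y * s = y * (y ^ n * s * x ^ n) := by rw [← h2]
      _ = (y ^ n * y) * s * x ^ n := by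
        rw [(Commute.pow_self y n).eq]; simp only [mul_assoc]
      _ = s := by rw [hn, ← h2]
  rw [h1, h3, ← hx]

end Algebra

/-! ### Word types determine the value in a DA monoid -/

section Words

variable {A : Type u} {M : Type*} [Monoid M]

theorem exists_strict_factorization (ρ : List A → M) (hnil : ρ [] = 1)
    (happ : ∀ u v, ρ (u ++ v) = ρ u * ρ v) (s : M) (u : List A) (h : ¬ s * ρ u ∣ s) :
    ∃ u₀ a u₁, u = u₀ ++ a :: u₁ ∧ s * ρ u₀ ∣ s ∧ ¬ s * ρ u₀ * ρ [a] ∣ s := by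
  induction u using List.reverseRecOn with
  | nil => simp [hnil] at h
  | append_singleton u a ih =>
    by_cases hu : s * ρ u ∣ s
    · exact ⟨u, a, [], rfl, hu, by rwa [mul_assoc, ← happ]⟩
    · obtain ⟨u₀, b, u₁, rfl, h1, h2⟩ := ih hu
      exact ⟨u₀, b, u₁ ++ [a], by simp, h1, h2⟩

/-- A sequence of equivalence relations on words, compatible with the factorization of words at
the first occurrence of a letter. -/
structure IsFirstRefining (E : ℕ → List A → List A → Prop) : Prop where
  mono : ∀ {k m u v}, m ≤ k → E k u v → E m u v
  factor : ∀ {k u₀ a u₁ v}, a ∉ u₀ → E (k + 1) (u₀ ++ a :: u₁) v →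
    ∃ v₀ v₁, v = v₀ ++ a :: v₁ ∧ E k u₀ v₀ ∧ E k u₁ v₁

/-- Induction on `s` down the strict order of right ideals, over all words with at most `m` letters.
The property `hM` of DA is a hypothesis so that the result also serves the opposite monoid. -/
theorem IsFirstRefining.exists_dvd [Finite A] [Finite M] {E : ℕ → List A → List A → Prop}
    (hE : IsFirstRefining E) (ρ : List A → M) (hnil : ρ [] = 1)
    (happ : ∀ u v, ρ (u ++ v) = ρ u * ρ v)
    (hM : ∀ t c x b y : M, t * c = t → c = x * b * y → t * b ∣ t) {m n : ℕ}
    (hm : ∀ u v, {a | a ∈ u}.ncard < m → E n u v → ρ u = ρ v) (s : M) :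
    ∃ N, ∀ u v, {a | a ∈ u}.ncard ≤ m → E N u v → s * ρ u ∣ s * ρ v := by
  let r : M → M → Prop := fun s t => t ∣ s ∧ ¬ s ∣ t
  have : IsTrans M r := ⟨fun a b c h1 h2 => ⟨h2.1.trans h1.1, fun h => h2.2 (h1.1.trans h)⟩⟩
  have : Std.Irrefl r := ⟨fun a h => h.2 h.1⟩
  induction s using (Finite.wellFounded_of_trans_of_irrefl r).induction with
  | _ s ih =>
    have ih' : ∀ t : M, ∃ N, r t s → ∀ u v, {a | a ∈ u}.ncard ≤ m → E N u v →
        t * ρ u ∣ t * ρ v := by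
      intro t
      by_cases ht : r t s
      · obtain ⟨N, hN⟩ := ih t ht
        exact ⟨N, fun _ => hN⟩
      · exact ⟨0, fun h => (ht h).elim⟩
    choose f hf using ih'
    obtain ⟨B, hB⟩ := (Set.finite_range f).bddAbove
    refine ⟨max n B + 1, fun u v hu huv => ?_⟩
    by_cases hs : s * ρ u ∣ s
    · exact hs.trans (dvd_mul_right _ _)
    obtain ⟨u₀, a, u₁, rfl, h1, h2⟩ := exists_strict_factorization ρ hnil happ s u hs
    -- If `a` occurred in `u₀`, then `s * ρ u₀` would be fixed by a product with factor `ρ [a]`, and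
    -- reading `a` could not leave the ideal.
    have ha : a ∉ u₀ := by
      intro ha
      obtain ⟨l, l', rfl⟩ := List.append_of_mem ha
      obtain ⟨z, hz⟩ := id h1
      refine h2 ((hM _ (z * ρ (l ++ a :: l')) (z * ρ l) _ (ρ l') ?_ ?_).trans h1)
      · rw [← mul_assoc, ← hz]
      · rw [happ, ← List.singleton_append, happ]
        simp only [mul_assoc]
    obtain ⟨v₀, v₁, rfl, h3, h4⟩ := hE.factor ha huv
    have hlt : {b | b ∈ u₀}.ncard < {b | b ∈ u₀ ++ a :: u₁}.ncard :=
      Set.ncard_lt_ncard ⟨fun b hb => List.mem_append_left _ hb,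
        fun h => ha (h (by simp : a ∈ u₀ ++ a :: u₁))⟩ (Set.toFinite _)
    have hle : {b | b ∈ u₁}.ncard ≤ {b | b ∈ u₀ ++ a :: u₁}.ncard :=
      Set.ncard_le_ncard (fun b hb => List.mem_append_right _ (List.mem_cons_of_mem _ hb))
        (Set.toFinite _)
    have h5 := hm u₀ v₀ (by omega) (hE.mono (le_max_left _ _) h3)
    have h6 := hf (s * ρ u₀ * ρ [a]) ⟨⟨ρ u₀ * ρ [a], by rw [mul_assoc]⟩, h2⟩ u₁ v₁ (by omega)
      (hE.mono ((hB ⟨_, rfl⟩).trans (le_max_right _ _)) h4)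
    have hcons : ∀ w, ρ (a :: w) = ρ [a] * ρ w := happ [a]
    rw [happ, happ, hcons u₁, hcons v₁, ← h5]
    simpa only [mul_assoc] using h6

theorem isFirstRefining_wordType :
    IsFirstRefining fun k (u v : List A) => wordType k u = wordType k v :=
  ⟨wordType_eq_of_le, exists_first_factorization⟩

theorem isFirstRefining_wordType_reverse :
    IsFirstRefining fun k (u v : List A) => wordType k u.reverse = wordType k v.reverse := by
  refine ⟨wordType_eq_of_le, fun {k u₀ a u₁ v} ha h => ?_⟩
  obtain ⟨v₁, v₀, h1, h2, h3⟩ := exists_last_factorization (k := k) (u₀ := u₁.reverse)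
    (u₁ := u₀.reverse) (v := v.reverse) (a := a) (by simpa using ha) (by simpa using h)
  refine ⟨v₀.reverse, v₁.reverse, ?_, by simpa using h3, by simpa using h2⟩
  rw [← List.reverse_reverse v, h1]
  simp

open MulOpposite in
theorem InDA.exists_wordType_eq_imp [Finite A] (hM : InDA M) (ρ : List A → M) (hnil : ρ [] = 1)
    (happ : ∀ u v, ρ (u ++ v) = ρ u * ρ v) :
    ∃ n, ∀ u v : List A, wordType n u = wordType n v → ρ u = ρ v := by
  have := hM.1
  have : Finite Mᵐᵒᵖ := Finite.of_equiv M opEquiv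
  have key : ∀ m, ∃ n, ∀ u v : List A, {a | a ∈ u}.ncard < m → wordType n u = wordType n v →
      ρ u = ρ v := by
    intro m
    induction m with
    | zero => exact ⟨0, fun _ _ h => by omega⟩
    | succ m ih =>
      obtain ⟨n, hn⟩ := ih
      obtain ⟨N, hN⟩ := isFirstRefining_wordType.exists_dvd ρ hnil happ
        (fun t c x b y => hM.mul_dvd_of_mul_eq) hn 1
      -- Reversed words in the opposite monoid turn last occurrences into first ones and give left
      -- divisibility.
      obtain ⟨N', hN'⟩ := isFirstRefining_wordType_reverse.exists_dvd
        (fun u => op (ρ u.reverse)) (by simp [hnil]) (by simp [happ])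
        (fun t c x b y h1 h2 => by
          obtain ⟨z, hz⟩ := hM.exists_mul_mul_eq (t := unop t) (c := unop c) (x := unop y)
            (b := unop b) (y := unop x) (congrArg unop h1) (by
              rw [h2, unop_mul, unop_mul, mul_assoc])
          exact ⟨op z, unop_injective hz⟩)
        (m := m) (n := n)
        (fun u v h1 h2 => congrArg op (hn _ _ (by simpa using h1) h2)) 1
      have hL : ∀ u v : List A, {a | a ∈ u}.ncard ≤ m → wordType N' u = wordType N' v →
          ∃ z, ρ v = z * ρ u := by
        intro u v hu huv
        obtain ⟨z, hz⟩ := hN' u.reverse v.reverse (by simpa using hu) (by simpa using huv)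
        exact ⟨unop z, by simpa using congrArg unop hz⟩
      refine ⟨max N N', fun u v hu huv => ?_⟩
      have hset : {a | a ∈ v} = {a | a ∈ u} := Set.ext fun a => (mem_iff_of_wordType_eq huv a).symm
      have hu' : {a | a ∈ u}.ncard ≤ m := by omega
      have hv' : {a | a ∈ v}.ncard ≤ m := by rwa [hset]
      have h1 := wordType_eq_of_le (le_max_left _ _) huv
      have h2 := wordType_eq_of_le (le_max_right _ _) huv
      obtain ⟨y, hy⟩ := hL v u hv' h2.symm
      exact hM.eq_of_dvd (by simpa using hN u v hu' h1) hy
  obtain ⟨n, hn⟩ := key (Nat.card A + 1)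
  refine ⟨n, fun u v => hn u v ?_⟩
  have := Set.ncard_le_card {a | a ∈ u}
  omega

end Words

/-! ### Recognition and the syntactic monoid -/

section Recognition

variable {A : Type u} {L : Language A}

theorem Language.IsFODefinable.isRecognizedBy_wordTypeCon_quotient (h : L.IsFODefinable 2) :
    ∃ k, L.IsRecognizedBy (wordTypeCon A k).Quotient := by
  obtain ⟨k, hk⟩ := h.exists_mem_iff
  refine ⟨k, (wordTypeCon A k).mk', (wordTypeCon A k).mk' '' {w | FreeMonoid.toList w ∈ L},
    fun w => ⟨fun hw => ⟨_, hw, rfl⟩, ?_⟩⟩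
  rintro ⟨v, hv, hvw⟩
  exact (hk _ _ ((wordTypeCon A k).eq.1 hvw)).1 hv

theorem Language.IsRecognizedBy.isFODefinable [Finite A] {M : Type*} [Monoid M] (hM : InDA M)
    (h : L.IsRecognizedBy M) : L.IsFODefinable 2 := by
  obtain ⟨ρ, F, hF⟩ := h
  obtain ⟨n, hn⟩ := hM.exists_wordType_eq_imp (fun w : List A => ρ (FreeMonoid.ofList w))
    (map_one ρ) (fun u v => map_mul ρ (FreeMonoid.ofList u) (FreeMonoid.ofList v))
  refine isFODefinable_of_wordType (k := n) fun w w' hw => ?_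
  rw [hF, hF, hn w w' hw]

/-- Words with equal image under `ρ` are syntactically congruent, so finiteness and every identity
of `M` carry over. -/
theorem Language.IsRecognizedBy.inDA_syntacticMonoid {M : Type*} [Monoid M] (hM : InDA M)
    (h : L.IsRecognizedBy M) : InDA L.SyntacticMonoid := by
  obtain ⟨ρ, F, hF⟩ := h
  have hρ : ∀ x y : FreeMonoid A, ρ x = ρ y → L.syntacticCon x y := by
    intro x y hxy u v
    have h1 := hF (FreeMonoid.toList (u * x * v))
    have h2 := hF (FreeMonoid.toList (u * y * v))
    rw [FreeMonoid.ofList_toList, map_mul ρ, map_mul ρ] at h1 h2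
    rw [h1, h2, hxy]
  obtain ⟨hfin, n, ⟨hn, hidem⟩, hda⟩ := hM
  refine ⟨?_, n, ⟨hn, ?_⟩, ?_⟩
  · refine Finite.of_injective (fun c : L.SyntacticMonoid => ρ c.out) fun c d h => ?_
    rw [← Quotient.out_eq c, ← Quotient.out_eq d]
    exact Quotient.sound (hρ _ _ h)
  · rintro ⟨x⟩
    exact L.syntacticCon.eq.2 (hρ (x ^ n * x ^ n) (x ^ n) (by
      simpa using (hidem (ρ x)).eq))
  · rintro ⟨x⟩ ⟨y⟩
    exact L.syntacticCon.eq.2 (hρ ((x * y) ^ n * y * (x * y) ^ n) ((x * y) ^ n)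
      (by simpa using hda (ρ x) (ρ y)))

theorem Language.isRecognizedBy_syntacticMonoid (L : Language A) :
    L.IsRecognizedBy L.SyntacticMonoid := by
  refine ⟨L.syntacticCon.mk', L.syntacticCon.mk' '' {w | FreeMonoid.toList w ∈ L},
    fun w => ⟨fun hw => ⟨_, hw, rfl⟩, ?_⟩⟩
  rintro ⟨v, hv, hvw⟩
  have h := L.syntacticCon.eq.1 hvw 1 1
  simp only [one_mul, mul_one] at h
  exact h.1 hv

theorem InDA.of_mulEquiv {M N : Type*} [Monoid M] [Monoid N] (e : M ≃* N) (h : InDA M) :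
    InDA N := by
  obtain ⟨hfin, n, ⟨hn, hidem⟩, hda⟩ := h
  refine ⟨Finite.of_equiv M e.toEquiv, n, ⟨hn, fun x => ?_⟩, fun x y => ?_⟩
  · have h1 : e.symm x ^ n * e.symm x ^ n = e.symm x ^ n := hidem (e.symm x)
    refine e.symm.injective ?_
    simpa using h1
  · refine e.symm.injective ?_
    simpa using hda (e.symm x) (e.symm y)

theorem Language.IsRecognizedBy.of_mulEquiv {M N : Type*} [Monoid M] [Monoid N] (e : M ≃* N)
    (h : L.IsRecognizedBy M) : L.IsRecognizedBy N := by
  obtain ⟨ρ, F, hF⟩ := h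
  exact ⟨e.toMonoidHom.comp ρ, e.symm ⁻¹' F, fun w => by simpa using hF w⟩

end Recognition

theorem mainTheorem6 {A : Type*} [Finite A] (L : Language A) :
    (L.IsFODefinable 2 ↔ ∃ (M : Type) (_ : Monoid M), InDA M ∧ L.IsRecognizedBy M) ∧
      (L.IsFODefinable 2 ↔ InDA L.SyntacticMonoid) := by
  have h1 : L.IsFODefinable 2 → InDA L.SyntacticMonoid := fun h => by
    obtain ⟨k, hk⟩ := h.isRecognizedBy_wordTypeCon_quotient
    exact hk.inDA_syntacticMonoid (inDA_wordTypeCon_quotient A k)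
  refine ⟨⟨fun h => ?_, fun ⟨M, _, hM, hL⟩ => hL.isFODefinable hM⟩,
    h1, fun h => L.isRecognizedBy_syntacticMonoid.isFODefinable h⟩
  -- Finiteness gives the syntactic monoid a copy in `Type`, the universe of the required monoid.
  have := (h1 h).1
  have e : L.SyntacticMonoid ≃* Shrink.{0} L.SyntacticMonoid := Shrink.mulEquiv.symm
  exact ⟨Shrink.{0} L.SyntacticMonoid, inferInstance, (h1 h).of_mulEquiv e,
    L.isRecognizedBy_syntacticMonoid.of_mulEquiv e⟩
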